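/- Let $K$ be a field, and let $A$ and $B$ be finite-dimensional associative unital $K$-algebras. Write $A\text{-mod}$ and $B\text{-mod}$ for the categories of finite-dimensional left modules. Let $F: A\text{-mod}\to B\text{-mod}$ and $G: B\text{-mod}\to A\text{-mod}$ be functors (not assumed to be $K$-linear) which form a biadjoint pair, that is, $F$ is both left adjoint and right adjoint to $G$. Suppose that, for some integer $r>0$, the composite $F\circ G$ is isomorphic, as an endofunctor of $B\text{-mod}$, to the direct sum $\mathrm{Id}_{B\text{-mod}}^{\oplus r}$ of $r$ copies of the identity functor. If $A$ is a symmetric algebra over $K$, then $B$ is a symmetric algebra over $K$. Here a finite-dimensional $K$-algebra $R$ is called symmetric if there is a $K$-linear form $\tau: R\to K$ such that the bilinear form $(x,y)\mapsto\tau(xy)$ on $R$ is symmetric and non-degenerate. -/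

import Mathlib

open CategoryTheory

universe w u v

/-- The bilinear form `(x, y) ↦ τ (x * y)` on a `K`-algebra `R` attached to a `K`-linear form
`τ : R → K`. -/
def traceBilinForm {K : Type*} {R : Type*} [Field K] [Ring R] [Algebra K R] (τ : R →ₗ[K] K) :
    LinearMap.BilinForm K R :=
  (LinearMap.mul K R).compr₂ τ

/-- A `K`-algebra `R` is a symmetric algebra if it has a symmetrizing form: a `K`-linear form
`τ : R → K` such that the bilinear form `(x, y) ↦ τ (x * y)` is symmetric and non-degenerate. -/
def HasSymmetrizingForm (K : Type*) (R : Type*) [Field K] [Ring R] [Algebra K R] : Prop :=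
  ∃ τ : R →ₗ[K] K, (traceBilinForm τ).IsSymm ∧ (traceBilinForm τ).Nondegenerate

/-- The direct sum of `r` copies of the identity endofunctor of the category of finitely generated
left `R`-modules: it sends `N` to `N ^ r` and a map `f` to `f` acting in each coordinate. -/
def idCopies (R : Type u) [Ring R] (r : ℕ) : FGModuleCat.{v} R ⥤ FGModuleCat.{v} R where
  obj N := FGModuleCat.of R (Fin r → N)
  map {M N} f := FGModuleCat.ofHom
    (LinearMap.pi fun i => f.hom.hom ∘ₗ LinearMap.proj i : (Fin r → M) →ₗ[R] (Fin r → N))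

/-!
Write `X` for the regular `B`-module, `P = G X`, and let `R = End_A P`.

Since `G` is left adjoint to `F`, which preserves epimorphisms because it is also a left adjoint,
`P` is a projective `A`-module. The endomorphism algebra of a finitely generated projective module
over a symmetric algebra is symmetric (`HasSymmetrizingForm.end_of_projective`): with a dual basis
`p i`, `q i` of `P`, the form `f ↦ ∑ i, τ (q i (f (p i)))` is symmetrizing. So `R` is symmetric for
the action of `K` that comes from `A`.

On the other side, the adjunction `F ⊣ G` and the isomorphism `G ⋙ F ≅ Id ^ r` give
`R = Hom (G X, G X) ≃ Hom (F (G X), X) ≃ Hom (X ^ r, X) ≃ (Bᵐᵒᵖ) ^ r`, and by naturality this is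
an isomorphism of `(Bᵐᵒᵖ, Bᵐᵒᵖ)`-bimodules, where `Bᵐᵒᵖ = End X` acts on `R` through the functor
`G`. In particular the action of `K` on `B` makes `R` a `K`-algebra a second time. As `G` need not
be `K`-linear, the two structures are unrelated, except that both map `K` into the center of `R`.
Two facts then finish the proof.

* Being symmetric does not depend on the ground field (`HasSymmetrizingForm.of_ringEquiv`). If `C`
  is the center of an algebra `R` with symmetrizing form `τ` over `K`, then `x ↦ (c ↦ τ (x * c))`
  is a `C`-linear map from `R` to the `K`-dual of `C`. That dual has at most a one-dimensional
  `m`-torsion over `C ⧸ m` for each maximal ideal `m`, so over any other field `L` acting through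
  `C` it carries an `L`-linear form that vanishes on no nonzero `C`-submodule
  (`exists_separating_form_dual`). Composing the two gives a symmetrizing form over `L`.

* If `R` is symmetric and `R ≃ S ^ r` as `(S, S)`-bimodules, with `r > 0`, then `S` is symmetric
  (`HasSymmetrizingForm.of_free_extension`). Dualizing gives `S ^ r ≃ (S^*) ^ r`, hence bimodule
  maps `a k : S → S^*` and `b j : S^* → S` with `∑ j, b j ∘ a j = 1` in the center of `S`, which is
  artinian. By the Chinese remainder theorem some `∑ j k, c j * c k * (b j ∘ a k)` with central
  coefficients is a unit (`exists_isUnit_sum_mul_mul`), and then `∑ k, c k • a k` is injective.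
-/

/-! ### Symmetrizing forms -/

theorem hasSymmetrizingForm_iff {K R : Type*} [Field K] [Ring R] [Algebra K R] :
    HasSymmetrizingForm K R ↔ ∃ τ : R →ₗ[K] K, (∀ x y, τ (x * y) = τ (y * x)) ∧
      ∀ x, (∀ y, τ (x * y) = 0) → x = 0 := by
  have isRefl {τ : R →ₗ[K] K} (h : ∀ x y, τ (x * y) = τ (y * x)) :
      LinearMap.IsRefl (traceBilinForm τ) := fun x y hxy ↦ (h y x).trans hxy
  constructor
  · rintro ⟨τ, hs, hn⟩
    exact ⟨τ, hs.eq, hn.1⟩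
  · rintro ⟨τ, hs, hn⟩
    exact ⟨τ, ⟨hs⟩, (isRefl hs).nondegenerate_iff_separatingLeft.2 hn⟩

theorem HasSymmetrizingForm.of_mulOpposite {K R : Type*} [Field K] [Ring R] [Algebra K R]
    (h : HasSymmetrizingForm K Rᵐᵒᵖ) : HasSymmetrizingForm K R := by
  obtain ⟨τ, hs, hn⟩ := hasSymmetrizingForm_iff.1 h
  refine hasSymmetrizingForm_iff.2
    ⟨τ ∘ₗ (MulOpposite.opLinearEquiv K).toLinearMap, fun x y ↦ hs (.op y) (.op x), fun x hx ↦ ?_⟩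
  refine MulOpposite.op_injective (hn _ fun y ↦ ?_)
  rw [hs]
  exact hx y.unop

/-! ### Endomorphism algebras of projective modules -/

/-- The form on `End_A P` is the trace of `P` over `A` followed by the form of `A`. It is computed in
a dual basis, and it pairs `f` with the rank-one endomorphism `x ↦ φ x • y` to the value of the form
of `A` at `φ (f y)`. -/
theorem HasSymmetrizingForm.end_of_projective {K A P : Type*} [Field K] [Ring A] [Algebra K A]
    [AddCommGroup P] [Module A P] [Module K P] [IsScalarTower K A P] [SMulCommClass A K P]
    [Module.Finite A P] [Module.Projective A P] (hA : HasSymmetrizingForm K A) :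
    HasSymmetrizingForm K (Module.End A P) := by
  obtain ⟨τ, hs, hn⟩ := hasSymmetrizingForm_iff.1 hA
  obtain ⟨n, π, hπ⟩ := Module.Finite.exists_fin' A P
  obtain ⟨σ, hσ⟩ := Module.projective_lifting_property π LinearMap.id hπ
  -- `p` and `q` form a dual basis of `P`.
  let p (i : Fin n) : P := π (Pi.single i 1)
  let q (i : Fin n) : P →ₗ[A] A := LinearMap.proj i ∘ₗ σ
  have hpq (x : P) : ∑ i, q i x • p i = x := by
    have h1 : ∑ i, q i x • (Pi.single i 1 : Fin n → A) = σ x := by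
      ext j
      simp [q, Finset.sum_apply, Pi.single_apply]
    calc ∑ i, q i x • p i = π (∑ i, q i x • (Pi.single i 1 : Fin n → A)) := by simp [p, map_sum]
      _ = x := by rw [h1]; exact LinearMap.congr_fun hσ x
  let t : Module.End A P →ₗ[K] K :=
    { toFun f := ∑ i, τ (q i (f (p i)))
      map_add' f g := by simp [Finset.sum_add_distrib]
      map_smul' c f := by
        have h (i) : q i (c • f (p i)) = c • q i (f (p i)) := by
          rw [← algebraMap_smul A c (f (p i)), map_smul, algebraMap_smul]
        simp [h, Finset.mul_sum] }
  have ht (f g : Module.End A P) : t (f * g) = ∑ i, ∑ j, τ (q j (g (p i)) * q i (f (p j))) := by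
    have h (i) : f (g (p i)) = ∑ j, q j (g (p i)) • f (p j) := by
      conv_lhs => rw [← hpq (g (p i)), map_sum]
      simp
    calc t (f * g) = ∑ i, τ (q i (f (g (p i)))) := rfl
      _ = _ := by simp [h, map_sum]
  refine hasSymmetrizingForm_iff.2
    ⟨t, fun f g ↦ ?_, fun f hf ↦ ?_⟩
  · rw [ht, ht, Finset.sum_comm]
    simp_rw [hs]
  · refine LinearMap.ext fun y ↦ ?_
    rw [LinearMap.zero_apply, ← hpq (f y)]
    refine Finset.sum_eq_zero fun i _ ↦ ?_
    suffices q i (f y) = 0 by rw [this, zero_smul]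
    refine hn _ fun a ↦ ?_
    -- Pair `f` with the rank-one endomorphism `x ↦ (q i x * a) • y`.
    have h : ∑ k, τ (q k (f ((q i (p k) * a) • y))) = 0 :=
      hf ((LinearMap.toSpanSingleton A A a ∘ₗ q i).smulRight y)
    calc τ (q i (f y) * a) = τ (q i (∑ k, q k (f y) • p k) * a) := by rw [hpq]
      _ = ∑ k, τ (q k (f y) * (q i (p k) * a)) := by
        simp [map_sum, Finset.sum_mul, mul_assoc]
      _ = ∑ k, τ (q k (f ((q i (p k) * a) • y))) := by
        refine Finset.sum_congr rfl fun k _ ↦ ?_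
        rw [hs, map_smul, map_smul, smul_eq_mul]
      _ = 0 := h

/-! ### Independence of the ground field -/

/-- Every nonzero submodule of a module over a commutative artinian ring contains a simple one: the
element `c • x` spans a copy of `C ⧸ m`. -/
theorem exists_isMaximal_forall_smul_eq_zero {C E : Type*} [CommRing C] [IsArtinianRing C]
    [AddCommGroup E] [Module C E] {x : E} (hx : x ≠ 0) :
    ∃ (c : C) (m : Ideal C), m.IsMaximal ∧ c • x ≠ 0 ∧ ∀ a ∈ m, a • c • x = 0 := by
  let y : Submodule.span C {x} := ⟨x, Submodule.mem_span_singleton_self x⟩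
  have hy : y ≠ 0 := fun h ↦ hx (congrArg Subtype.val h)
  obtain ⟨m, hm, -⟩ := exists_le_isAssociatedPrime_of_isNoetherianRing C y hy
  obtain ⟨hp, ⟨z, hz⟩, rfl⟩ := isAssociatedPrime_iff.1 hm
  obtain ⟨c, rfl⟩ := Submodule.mem_span_singleton.1 hz
  refine ⟨c, _, Ideal.IsPrime.isMaximal' (hI := hp), fun h ↦ hp.ne_top ?_, fun a ha ↦ ?_⟩
  · rw [Ideal.eq_top_iff_one, Submodule.mem_colon_singleton, Submodule.mem_bot]
    exact Subtype.ext (by simpa using h)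
  · rw [Submodule.mem_colon_singleton, Submodule.mem_bot] at ha
    exact congrArg Subtype.val ha

/-- Lifts to an artinian ring of the primitive idempotents of its semisimple quotient. -/
theorem exists_mem_forall_ne_mem {C : Type*} [CommRing C] [IsArtinianRing C] :
    ∃ e : MaximalSpectrum C → C, (∀ m, e m - 1 ∈ m.asIdeal) ∧
      ∀ m m', m ≠ m' → e m ∈ m'.asIdeal := by
  classical
  have hcop : Pairwise (Function.onFun IsCoprime (MaximalSpectrum.asIdeal (R := C))) :=
    fun m m' h ↦ Ideal.isCoprime_of_isMaximal fun h' ↦ h (MaximalSpectrum.ext h')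
  choose e he using fun m : MaximalSpectrum C ↦
    Ideal.exists_forall_sub_mem_ideal hcop (Pi.single m (1 : C))
  exact ⟨e, fun m ↦ by simpa using he m m, fun m m' h ↦ by simpa [h.symm] using he m m'⟩

/-- If the socle of `E` contains each simple module at most once, then there is an `L`-linear form on
`E` that vanishes on no nonzero `C`-submodule. The hypothesis says that the `m`-torsion of `E` is at
most one-dimensional over `C ⧸ m`, so a form that is nonzero at one chosen vector of the `m`-torsion
deals with the whole of it; the elements `e m` glue these forms together. -/
theorem exists_linearMap_separating {C E L : Type*} [CommRing C] [IsArtinianRing C]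
    [AddCommGroup E] [Module C E] [Field L] [Algebra L C] [Module L E] [IsScalarTower L C E]
    (hE : ∀ m : Ideal C, m.IsMaximal → ∀ x y : E, (∀ a ∈ m, a • x = 0) → (∀ a ∈ m, a • y = 0) →
      x ≠ 0 → ∃ c : C, c • x = y) :
    ∃ l : E →ₗ[L] L, ∀ x : E, x ≠ 0 → ∃ c : C, l (c • x) ≠ 0 := by
  classical
  have := Fintype.ofFinite (MaximalSpectrum C)
  obtain ⟨e, he, he'⟩ := exists_mem_forall_ne_mem (C := C)
  have key (m : MaximalSpectrum C) : ∃ f : E →ₗ[L] L, ∀ x : E, (∀ a ∈ m.asIdeal, a • x = 0) →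
      x ≠ 0 → ∃ c : C, f (c • x) ≠ 0 := by
    by_cases h : ∃ y : E, (∀ a ∈ m.asIdeal, a • y = 0) ∧ y ≠ 0
    · obtain ⟨y, hy, hy0⟩ := h
      obtain ⟨f, hf⟩ := Module.Projective.exists_dual_eq_one L hy0
      refine ⟨f, fun x hx hx0 ↦ ?_⟩
      obtain ⟨c, rfl⟩ := hE _ m.isMaximal x y hx hy hx0
      exact ⟨c, by simp [hf]⟩
    · push Not at h
      exact ⟨0, fun x hx hx0 ↦ absurd (h x hx) hx0⟩
  choose f hf using key
  refine ⟨∑ m, f m ∘ₗ Algebra.lsmul L L E (e m), fun x hx ↦ ?_⟩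
  obtain ⟨c, m, hm, hc, hmc⟩ := exists_isMaximal_forall_smul_eq_zero (C := C) hx
  obtain ⟨d, hd⟩ := hf ⟨m, hm⟩ (c • x) hmc hc
  refine ⟨d * c, ?_⟩
  have hkill (a : C) (ha : a ∈ m) : a • (d * c) • x = 0 := by
    rw [mul_smul, smul_comm, hmc a ha, smul_zero]
  rw [LinearMap.sum_apply, Finset.sum_eq_single ⟨m, hm⟩]
  · have h := hkill _ (he ⟨m, hm⟩)
    rw [sub_smul, one_smul, sub_eq_zero] at h
    change f ⟨m, hm⟩ (e ⟨m, hm⟩ • (d * c) • x) ≠ 0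
    rwa [h, mul_smul]
  · intro m' _ h
    simp [hkill _ (he' m' ⟨m, hm⟩ h)]
  · simp

/-- The `C`-module structure on the `K`-dual of a commutative `K`-algebra `C`, in which `c` acts by
precomposition with multiplication by `c`. -/
@[reducible] def dualModule (K C : Type*) [Field K] [CommRing C] [Algebra K C] :
    Module C (Module.Dual K C) where
  smul c f := f ∘ₗ LinearMap.mulLeft K c
  one_smul f := LinearMap.ext fun x ↦ congrArg f (one_mul x)
  mul_smul c d f := LinearMap.ext fun x ↦ congrArg f (by simp [mul_left_comm])
  smul_zero c := LinearMap.zero_comp _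
  smul_add c f g := LinearMap.add_comp _ _ _
  zero_smul f := LinearMap.ext fun x ↦ by
    change f (0 * x) = 0
    simp
  add_smul c d f := LinearMap.ext fun x ↦ by
    change f ((c + d) * x) = f (c * x) + f (d * x)
    rw [add_mul, map_add]

/-- The `m`-torsion of the `K`-dual of `C`, that is the `K`-dual of `C ⧸ m`, is one-dimensional over
the field `C ⧸ m`: the orbit map of `f ≠ 0` has kernel `m`, and dimensions over `K` agree. -/
theorem exists_dual_smul_eq {K C : Type*} [Field K] [CommRing C] [Algebra K C]
    [FiniteDimensional K C] {m : Ideal C} (hm : m.IsMaximal) {f g : Module.Dual K C}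
    (hf : ∀ a ∈ m, f a = 0) (hg : ∀ a ∈ m, g a = 0) (hf0 : f ≠ 0) :
    ∃ c : C, ∀ x, f (c * x) = g x := by
  let T : C →ₗ[K] Module.Dual K C := (LinearMap.mul K C).compr₂ f
  let M : Subspace K C := m.restrictScalars K
  have hker : LinearMap.ker T = M := by
    ext a
    refine ⟨fun ha ↦ ?_, fun ha ↦ LinearMap.ext fun x ↦ hf _ (m.mul_mem_right x ha)⟩
    by_contra ham
    obtain ⟨b, i, hi, hb⟩ := Ideal.IsMaximal.exists_inv hm ham
    refine hf0 (LinearMap.ext fun x ↦ ?_)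
    have h1 : f (a * (b * x)) = 0 := LinearMap.congr_fun ha (b * x)
    have h2 : f (i * x) = 0 := hf _ (m.mul_mem_right x hi)
    calc f x = f (a * (b * x) + i * x) := by
          rw [← mul_assoc, mul_comm a, ← add_mul, hb, one_mul]
      _ = 0 := by rw [map_add, h1, h2, add_zero]
  have hle : LinearMap.range T ≤ M.dualAnnihilator := by
    rintro _ ⟨c, rfl⟩
    exact (Submodule.mem_dualAnnihilator _).2 fun a ha ↦ hf _ (m.mul_mem_left c ha)
  have hrange : LinearMap.range T = M.dualAnnihilator := by
    refine Submodule.eq_of_le_of_finrank_eq hle ?_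
    have h1 := T.finrank_range_add_finrank_ker
    have h2 := Subspace.finrank_add_finrank_dualAnnihilator_eq M
    rw [hker] at h1
    omega
  have hgT : g ∈ LinearMap.range T := hrange ▸ (Submodule.mem_dualAnnihilator _).2 hg
  obtain ⟨c, hc⟩ := hgT
  exact ⟨c, fun x ↦ LinearMap.congr_fun hc x⟩

/-- The form `l` on the `K`-dual of `C` is linear over `L`, acting through `C`, and vanishes on no
nonzero `C`-submodule. The fields `K` and `L` are related only by having images in `C`. -/
theorem exists_separating_form_dual (K L C : Type*) [Field K] [Field L] [CommRing C] [Algebra K C]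
    [FiniteDimensional K C] [Algebra L C] :
    ∃ l : Module.Dual K C →+ L,
      (∀ (z : L) f, l (f ∘ₗ LinearMap.mulLeft K (algebraMap L C z)) = z * l f) ∧
      ∀ f, f ≠ 0 → ∃ c, l (f ∘ₗ LinearMap.mulLeft K c) ≠ 0 := by
  let := dualModule K C
  let : Module L (Module.Dual K C) := Module.compHom _ (algebraMap L C)
  have : IsScalarTower L C (Module.Dual K C) := IsScalarTower.of_algebraMap_smul fun _ _ ↦ rfl
  have : IsArtinianRing C := IsArtinianRing.of_finite K C
  obtain ⟨l, hl⟩ := exists_linearMap_separating (C := C) (E := Module.Dual K C) (L := L) (by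
    intro m hm f g hf hg hf0
    have h (f : Module.Dual K C) (hf : ∀ a ∈ m, a • f = 0) (a) (ha : a ∈ m) : f a = 0 := by
      have h1 : f (a * 1) = 0 := LinearMap.congr_fun (hf a ha) 1
      rwa [mul_one] at h1
    obtain ⟨c, hc⟩ := exists_dual_smul_eq hm (h f hf) (h g hg) hf0
    exact ⟨c, LinearMap.ext hc⟩)
  exact ⟨l.toAddMonoidHom, fun z f ↦ l.map_smul z f, hl⟩

/-- Whether a ring is a symmetric algebra does not depend on the field over which it is considered;
the ring isomorphism `e` is not assumed to respect any scalars. -/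
theorem HasSymmetrizingForm.of_ringEquiv {K L R S : Type*} [Field K] [Field L] [Ring R] [Ring S]
    [Algebra K R] [Algebra L S] [FiniteDimensional K R] (e : S ≃+* R)
    (h : HasSymmetrizingForm K R) : HasSymmetrizingForm L S := by
  obtain ⟨τ, hs, hn⟩ := hasSymmetrizingForm_iff.1 h
  let C := Subalgebra.center K R
  have hmem (z : L) : e (algebraMap L S z) ∈ C := Subalgebra.mem_center_iff.2 fun b ↦ by
    obtain ⟨b, rfl⟩ := e.surjective b
    rw [← map_mul, ← map_mul, Algebra.commutes]
  let : Algebra L C :=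
    ((e.toRingHom.comp (algebraMap L S)).codRestrict C.toSubring hmem).toAlgebra
  obtain ⟨l, hl, hl'⟩ := exists_separating_form_dual K L C
  let T (x : S) : Module.Dual K C := τ ∘ₗ LinearMap.mulLeft K (e x) ∘ₗ C.val.toLinearMap
  have hT (x : S) (c : C) : T x c = τ (e x * c) := rfl
  let t : S →ₗ[L] L :=
    { toFun x := l (T x)
      map_add' x y := by
        rw [← map_add]
        congr 1
        ext c
        simp [hT, add_mul]
      map_smul' z x := by
        rw [RingHom.id_apply, smul_eq_mul, ← hl]
        congr 1
        ext c
        have h := Algebra.commutes z x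
        calc τ (e (z • x) * c) = τ (e (x * algebraMap L S z) * c) := by
              rw [← h, Algebra.smul_def]
          _ = τ (e x * (e (algebraMap L S z) * c)) := by rw [map_mul e, mul_assoc] }
  refine hasSymmetrizingForm_iff.2 ⟨t, fun x y ↦ congrArg l (LinearMap.ext fun c ↦ ?_),
    fun x hx ↦ ?_⟩
  · have hc := Subalgebra.mem_center_iff.1 c.2
    calc τ (e (x * y) * c) = τ (e x * (e y * c)) := by rw [map_mul e, mul_assoc]
      _ = τ (e y * (e x * c)) := by rw [hs, mul_assoc, ← hc]
      _ = τ (e (y * x) * c) := by rw [map_mul e, mul_assoc]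
  · by_contra hx0
    obtain ⟨y, hy⟩ : ∃ y, T (x * y) ≠ 0 := by
      by_contra! hall
      refine hx0 (e.injective ((hn _ fun y ↦ ?_).trans (map_zero e).symm))
      have h1 : τ (e (x * e.symm y) * (1 : C)) = 0 := LinearMap.congr_fun (hall (e.symm y)) 1
      simpa using h1
    obtain ⟨c, hc⟩ := hl' _ hy
    refine hc ((congrArg l (LinearMap.ext fun d ↦ ?_)).trans (hx (y * e.symm c)))
    calc τ (e (x * y) * (c * d)) = τ (e (x * (y * e.symm c)) * d) := by
          simp [map_mul e, mul_assoc]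

/-! ### Descent along a free extension -/

/-- For each maximal ideal `m` some diagonal entry `z (i m) (i m)` lies outside `m`. The Chinese
remainder theorem gives coefficients `c` that reduce modulo `m` to the indicator of `i m`, so that
the quadratic form in `c` reduces to that entry. -/
theorem exists_isUnit_sum_mul_mul {C ι : Type*} [CommRing C] [IsArtinianRing C] [Fintype ι]
    (z : ι → ι → C) (hz : ∑ j, z j j = 1) :
    ∃ c : ι → C, IsUnit (∑ j, ∑ k, c j * c k * z j k) := by
  classical
  have := Fintype.ofFinite (MaximalSpectrum C)
  obtain ⟨e, he, he'⟩ := exists_mem_forall_ne_mem (C := C)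
  have hex (m : MaximalSpectrum C) : ∃ j, z j j ∉ m.asIdeal := by
    by_contra! h
    exact (Ideal.ne_top_iff_one _).1 m.isMaximal.ne_top (hz ▸ sum_mem fun j _ ↦ h j)
  choose i hi using hex
  let c (j : ι) : C := ∑ m, if i m = j then e m else 0
  have hc (m : MaximalSpectrum C) (j : ι) :
      Ideal.Quotient.mk m.asIdeal (c j) = if i m = j then 1 else 0 := by
    simp only [c, map_sum]
    rw [Finset.sum_eq_single m]
    · split_ifs
      · exact (Ideal.Quotient.mk_eq_mk_iff_sub_mem _ _).2 (he m)
      · exact map_zero _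
    · intro m' _ h
      split_ifs
      · exact Ideal.Quotient.eq_zero_iff_mem.2 (he' m' m h)
      · exact map_zero _
    · simp
  refine ⟨c, ?_⟩
  by_contra hu
  obtain ⟨m, hm, hmem⟩ := exists_max_ideal_of_mem_nonunits hu
  refine hi ⟨m, hm⟩ (Ideal.Quotient.eq_zero_iff_mem.1 ?_)
  have h := Ideal.Quotient.eq_zero_iff_mem.2 hmem
  simpa [map_sum, hc ⟨m, hm⟩] using h

/-- A symmetric algebra `R` over `S` that is a nonzero finite power of `S` as an `(S, S)`-bimodule
forces `S` to be symmetric. This replaces the cancellation of `r` in `S ^ r ≃ (S^*) ^ r`. -/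
theorem HasSymmetrizingForm.of_free_extension {K S R ι : Type*} [Field K] [Ring S] [Algebra K S]
    [FiniteDimensional K S] [Ring R] [Algebra K R] [Fintype ι] [Nonempty ι] (f : S →ₐ[K] R)
    (φ : R ≃+ (ι → S)) (hl : ∀ s x j, φ (f s * x) j = s * φ x j)
    (hr : ∀ s x j, φ (x * f s) j = φ x j * s) (hR : HasSymmetrizingForm K R) :
    HasSymmetrizingForm K S := by
  classical
  obtain ⟨τ, hs, hn⟩ := hasSymmetrizingForm_iff.1 hR
  obtain ⟨o⟩ := ‹Nonempty ι›
  let φK : R ≃ₗ[K] (ι → S) :=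
    { φ with
      map_smul' c x := funext fun j ↦ by
        have h := hl (algebraMap K S c) x j
        rw [AlgHom.commutes, ← Algebra.smul_def, ← Algebra.smul_def] at h
        exact h }
  have : FiniteDimensional K R := φK.symm.finiteDimensional
  let u (j : ι) : R := φ.symm (Pi.single j 1)
  -- The elements `u j` form a basis of `R` over `S` and commute with `S`.
  have hφ (s : S) (j : ι) : φ (f s * u j) = Pi.single j s := by
    ext k
    rw [hl, AddEquiv.apply_symm_apply]
    by_cases h : k = j
    · subst h; simp
    · simp [h]
  have hu (s : S) (j : ι) : f s * u j = u j * f s := by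
    refine φ.injective ?_
    rw [hφ]
    ext k
    rw [hr, AddEquiv.apply_symm_apply]
    by_cases h : k = j
    · subst h; simp
    · simp [h]
  have hsum (x : R) : ∑ j, f (φ x j) * u j = x := by
    refine φ.injective ?_
    rw [map_sum]
    simp_rw [hφ]
    exact Finset.univ_sum_single _
  -- The symmetrizing form of `S` is a combination, with central coefficients, of the forms `a k`.
  let a (k : ι) : S →ₗ[K] K := τ ∘ₗ LinearMap.mulRight K (u o * u k) ∘ₗ f.toLinearMap
  have ha' (k : ι) (s : S) : a k s = τ (f s * (u o * u k)) := rfl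
  have ha (k : ι) (s t : S) : a k (s * t) = a k (t * s) := by
    have h1 : f t * (u o * u k) = u o * u k * f t := by
      rw [← mul_assoc, hu, mul_assoc, hu, mul_assoc]
    rw [ha', ha', map_mul f, map_mul f, mul_assoc, h1, ← mul_assoc, hs, ← mul_assoc, ← mul_assoc]
  -- The element `g j k` of `R` represents the functional `x ↦ a k (φ x j)`.
  have hnd : (traceBilinForm τ).Nondegenerate :=
    LinearMap.IsRefl.nondegenerate_iff_separatingLeft (fun x y h ↦ (hs y x).trans h) |>.2 hn
  have hex (j k : ι) : ∃ g : R, ∀ x, τ (g * x) = a k (φ x j) := by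
    obtain ⟨g, hg⟩ := ((traceBilinForm τ).toDual hnd).surjective
      (a k ∘ₗ LinearMap.proj j ∘ₗ φK.toLinearMap)
    exact ⟨g, LinearMap.congr_fun hg⟩
  choose g hg using hex
  have hext {x y : R} (h : ∀ w, τ (x * w) = τ (y * w)) : x = y :=
    sub_eq_zero.1 (hn _ fun w ↦ by rw [sub_mul, map_sub, h, sub_self])
  have hgf (s : S) (j k : ι) : f s * g j k = g j k * f s := hext fun w ↦ by
    rw [hs, ← mul_assoc, hs, hg, hr, mul_assoc, hg, hl, ha]
  have hgsum : ∑ j, g j j = u o := hext fun w ↦ by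
    conv_rhs => rw [← hsum w]
    rw [Finset.sum_mul, Finset.mul_sum, map_sum, map_sum]
    refine Finset.sum_congr rfl fun j _ ↦ ?_
    rw [hg, ha', ← mul_assoc, ← mul_assoc, hu]
  -- The coordinate of `g j k` at `o` is the central element by which `b j ∘ a k` acts on `S`, where
  -- `b j : S^* → S` sends a functional `α` to the coordinate at `o` of the element of `R` that
  -- represents `x ↦ α (φ x j)`.
  let C := Subalgebra.center K S
  have : IsArtinianRing C := IsArtinianRing.of_finite K C
  let z (j k : ι) : C := ⟨φ (g j k) o, Subalgebra.mem_center_iff.2 fun s ↦ by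
    rw [← hl, hgf, hr]⟩
  obtain ⟨c, hc⟩ := exists_isUnit_sum_mul_mul z (Subtype.ext (by
    have h : φ (u o) o = 1 := by simp [u]
    rw [← hgsum, map_sum, Finset.sum_apply] at h
    simpa [z] using h))
  have hcc (j : ι) (s : S) : s * c j = c j * s := Subalgebra.mem_center_iff.1 (c j).2 s
  let t : S →ₗ[K] K := ∑ k, a k ∘ₗ LinearMap.mulLeft K (c k : S)
  have ht (s : S) : t s = ∑ k, a k (c k * s) := by simp [t]
  refine hasSymmetrizingForm_iff.2 ⟨t, fun x y ↦ ?_, fun s hst ↦ ?_⟩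
  · rw [ht, ht]
    refine Finset.sum_congr rfl fun k _ ↦ ?_
    rw [← mul_assoc, ha, ← mul_assoc, hcc, mul_assoc]
  -- If `s` is in the radical of the form, then so is `f s` times the element below, whose
  -- coordinate at `o` is a central unit of `S`.
  · have hx : f s * ∑ j, ∑ k, f (c j * c k) * g j k = 0 := hn _ fun w ↦ by
      have h (j k) : τ (f s * (f (c j * c k) * g j k) * w) =
          a k (c k * (s * (c j * φ w j))) := by
        rw [← mul_assoc, ← map_mul f, hgf, mul_assoc, hg, hl, ← mul_assoc s, ← mul_assoc s,
          hcc k]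
        congr 1
        simp only [mul_assoc]
      simp_rw [Finset.mul_sum, Finset.sum_mul, map_sum, h, ← ht, hst]
      simp
    have h1 : s * ((∑ j, ∑ k, c j * c k * z j k : C) : S) = 0 := by
      have h2 : φ (f s * ∑ j, ∑ k, f (c j * c k) * g j k) o = 0 := by rw [hx]; simp
      simp only [hl, map_sum, Finset.sum_apply] at h2
      simpa [z] using h2
    exact ((hc.map C.val).mul_left_eq_zero).1 h1

/-! ### Categories of finitely generated modules -/

theorem FGModuleCat.projective_of_self (R : Type u) [Ring R] [IsNoetherianRing R] :
    Projective (FGModuleCat.of R R) where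
  factors {M N} f g hg := by
    have : Epi ((forget₂ (FGModuleCat R) (ModuleCat R)).map g) := inferInstance
    have hsurj : Function.Surjective g.hom.hom := (ModuleCat.epi_iff_surjective _).1 this
    obtain ⟨l, hl⟩ := Module.projective_lifting_property g.hom.hom f.hom.hom hsurj
    exact ⟨FGModuleCat.ofHom l, FGModuleCat.hom_ext hl⟩

theorem FGModuleCat.module_projective (R : Type u) [Ring R] (P : FGModuleCat.{u} R)
    [Projective P] : Module.Projective R P := by
  obtain ⟨n, π, hπ⟩ := Module.Finite.exists_fin' R P
  let p : FGModuleCat.of R (Fin n → R) ⟶ P := ⟨ModuleCat.ofHom π⟩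
  have : Epi ((forget₂ (FGModuleCat R) (ModuleCat R)).map p) :=
    (ModuleCat.epi_iff_surjective _).2 hπ
  have : Epi p := (forget₂ (FGModuleCat R) (ModuleCat R)).epi_of_epi_map this
  refine Module.Projective.of_split (Projective.factorThru (𝟙 P) p).hom.hom π ?_
  exact congrArg (fun f : P ⟶ P ↦ f.hom.hom) (Projective.factorThru_comp (𝟙 P) p)

/-- Endomorphisms in the category of finitely generated modules are linear endomorphisms. -/
def FGModuleCat.endRingEquiv {R : Type u} [Ring R] (M : FGModuleCat.{v} R) :
    End M ≃+* Module.End R M where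
  toFun f := f.hom.hom
  invFun f := ⟨ModuleCat.ofHom f⟩
  left_inv _ := rfl
  right_inv _ := rfl
  map_mul' _ _ := rfl
  map_add' _ _ := rfl

/-- A right adjoint preserves binary products, hence addition of morphisms. -/
theorem FGModuleCat.additive_of_adjunction {R : Type u} {S : Type v} [Ring R] [Ring S]
    [IsNoetherianRing R] [IsNoetherianRing S]
    {F : FGModuleCat.{u} R ⥤ FGModuleCat.{v} S} {G : FGModuleCat.{v} S ⥤ FGModuleCat.{u} R}
    (adj : F ⊣ G) : G.Additive := by
  have := adj.isRightAdjoint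
  have : Limits.PreservesLimitsOfShape (Discrete Limits.WalkingPair) G :=
    (adj.rightAdjoint_preservesLimits.{0, 0}).preservesLimitsOfShape
  exact Functor.additive_of_preserves_binary_products G

/-- Right multiplication, as a ring homomorphism to the endomorphisms of the regular left module. -/
def FGModuleCat.mulRightHom (R : Type u) [Ring R] : Rᵐᵒᵖ →+* End (FGModuleCat.of R R) :=
  (FGModuleCat.endRingEquiv _).symm.toRingHom.comp (RingEquiv.moduleEndSelf R).toRingHom

/-- The ring homomorphism on endomorphisms induced by an additive functor. -/
def endMapRingHom {C D : Type*} [Category* C] [Category* D] [Preadditive C] [Preadditive D]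
    (G : C ⥤ D) [G.Additive] (X : C) : End X →+* End (G.obj X) :=
  { Functor.mapEnd X G with
    map_zero' := G.map_zero X X
    map_add' := fun _ _ ↦ G.map_add }

/-- A morphism `R ^ r ⟶ R` of left modules is given by the images of the `r` standard basis vectors.
They are taken in `Rᵐᵒᵖ`, so that composition with right multiplications becomes multiplication on
either side. -/
def homIdCopiesEquiv (R : Type u) [Ring R] (r : ℕ) :
    ((idCopies R r).obj (FGModuleCat.of R R) ⟶ FGModuleCat.of R R) ≃+ (Fin r → Rᵐᵒᵖ) where
  toFun g i := .op (g.hom.hom (Pi.single i (1 : R) : Fin r → R))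
  invFun b := FGModuleCat.ofHom
    (∑ i, LinearMap.toSpanSingleton R R (b i).unop ∘ₗ LinearMap.proj i : (Fin r → R) →ₗ[R] R)
  left_inv g := FGModuleCat.hom_ext <| LinearMap.pi_ext' fun i ↦ LinearMap.ext_ring <| by
    change (∑ j, LinearMap.toSpanSingleton R R (g.hom.hom (Pi.single j (1 : R) : Fin r → R)) ∘ₗ
      LinearMap.proj j : (Fin r → R) →ₗ[R] R) (Pi.single i 1) = _
    simp [LinearMap.sum_apply, Pi.single_apply]
    rfl
  right_inv b := funext fun i ↦ MulOpposite.unop_injective <| by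
    change (∑ j, LinearMap.toSpanSingleton R R (b j).unop ∘ₗ
      LinearMap.proj j : (Fin r → R) →ₗ[R] R) (Pi.single i 1) = _
    simp [LinearMap.sum_apply, Pi.single_apply]
  map_add' _ _ := rfl

theorem homIdCopiesEquiv_comp_mulRightHom {R : Type u} [Ring R] {r : ℕ} (b : Rᵐᵒᵖ)
    (g : (idCopies R r).obj (FGModuleCat.of R R) ⟶ FGModuleCat.of R R) (i : Fin r) :
    homIdCopiesEquiv R r (g ≫ FGModuleCat.mulRightHom R b) i = b * homIdCopiesEquiv R r g i :=
  rfl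

theorem homIdCopiesEquiv_map_comp {R : Type u} [Ring R] {r : ℕ} (b : Rᵐᵒᵖ)
    (g : (idCopies R r).obj (FGModuleCat.of R R) ⟶ FGModuleCat.of R R) (i : Fin r) :
    homIdCopiesEquiv R r ((idCopies R r).map (FGModuleCat.mulRightHom R b) ≫ g) i =
      homIdCopiesEquiv R r g i * b := by
  have h : (fun j ↦ (Pi.single i (1 : R) : Fin r → R) j * b.unop) =
      b.unop • (Pi.single i (1 : R) : Fin r → R) := by
    ext j
    by_cases hj : j = i
    · subst hj; simp
    · simp [hj]
  exact congrArg MulOpposite.op ((congrArg g.hom.hom h).trans (map_smul g.hom.hom _ _))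

/-! ### Biadjoint functors -/

theorem lemmaA1 (K : Type w) [Field K]
    (A : Type u) [Ring A] [Algebra K A] [FiniteDimensional K A]
    (B : Type v) [Ring B] [Algebra K B] [FiniteDimensional K B]
    (F : FGModuleCat.{u} A ⥤ FGModuleCat.{v} B) (G : FGModuleCat.{v} B ⥤ FGModuleCat.{u} A)
    (adjFG : F ⊣ G) (adjGF : G ⊣ F)
    (r : ℕ) (hr : 0 < r) (e : G ⋙ F ≅ idCopies B r)
    (hA : HasSymmetrizingForm K A) :
    HasSymmetrizingForm K B := by
  have : IsNoetherianRing A := IsNoetherianRing.of_finite K A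
  have : IsNoetherianRing B := IsNoetherianRing.of_finite K B
  have : G.Additive := FGModuleCat.additive_of_adjunction adjFG
  have : F.Additive := FGModuleCat.additive_of_adjunction adjGF
  have : NeZero r := ⟨hr.ne'⟩
  let X := FGModuleCat.of B B
  let P := G.obj X
  -- The endomorphism ring of `P` is symmetric for the action of `K` that comes from `A`.
  have : Projective X := FGModuleCat.projective_of_self B
  have := adjFG.isLeftAdjoint
  have : Projective P := adjGF.map_projective X inferInstance
  have : Module.Projective A P := FGModuleCat.module_projective A P
  let : Module K P := Module.compHom P (algebraMap K A)
  have : IsScalarTower K A P := IsScalarTower.of_algebraMap_smul fun _ _ ↦ rfl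
  have : SMulCommClass A K P := IsScalarTower.to_smulCommClass'
  have : FiniteDimensional K P := Module.Finite.trans A P
  have : FiniteDimensional K (Module.End A P) :=
    FiniteDimensional.of_injective (LinearMap.restrictScalarsₗ K A P P K)
      (LinearMap.restrictScalars_injective K)
  have hP : HasSymmetrizingForm K (Module.End A P) := hA.end_of_projective
  -- It is a power of `Bᵐᵒᵖ` as a bimodule, and so a `K`-algebra through the action of `K` on `B`.
  let f : Bᵐᵒᵖ →+* End P := (endMapRingHom G X).comp (FGModuleCat.mulRightHom B)
  let ψ : End P ≃+ ((idCopies B r).obj X ⟶ X) :=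
    { ((adjFG.homEquiv P X).symm.trans (e.app X).homFromEquiv) with
      map_add' h h' := by
        have hF : F.map (h + h') = F.map h + F.map h' := F.map_add
        simp [Adjunction.homEquiv_counit, hF] }
  have hψ (h : End P) : ψ h = e.inv.app X ≫ (adjFG.homEquiv P X).symm h := rfl
  have hψl (b : Bᵐᵒᵖ) (h : End P) : ψ (f b * h) = ψ h ≫ FGModuleCat.mulRightHom B b := by
    have := adjFG.homEquiv_naturality_right_symm h (FGModuleCat.mulRightHom B b)
    rw [hψ, hψ, Category.assoc, ← this]
    rfl
  have hψr (b : Bᵐᵒᵖ) (h : End P) :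
      ψ (h * f b) = (idCopies B r).map (FGModuleCat.mulRightHom B b) ≫ ψ h := by
    have h1 := adjFG.homEquiv_naturality_left_symm (G.map (FGModuleCat.mulRightHom B b)) h
    have h2 := e.inv.naturality (FGModuleCat.mulRightHom B b)
    rw [hψ, hψ, ← Category.assoc, h2, Category.assoc]
    exact congrArg _ h1
  let φ : End P ≃+ (Fin r → Bᵐᵒᵖ) := ψ.trans (homIdCopiesEquiv B r)
  have hφl (b h i) : φ (f b * h) i = b * φ h i :=
    (congrArg (homIdCopiesEquiv B r · i) (hψl b h)).trans
      (homIdCopiesEquiv_comp_mulRightHom b (ψ h) i)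
  have hφr (b h i) : φ (h * f b) i = φ h i * b :=
    (congrArg (homIdCopiesEquiv B r · i) (hψr b h)).trans
      (homIdCopiesEquiv_map_comp b (ψ h) i)
  -- Scalars are central in `End P` because left and right multiplication by them agree on `Bᵐᵒᵖ`.
  let : Algebra K (End P) := (f.comp (algebraMap K Bᵐᵒᵖ)).toAlgebra' fun z h ↦ by
    refine φ.injective (funext fun i ↦ ?_)
    simp only [RingHom.comp_apply, hφl, hφr, Algebra.commutes]
  exact ((hP.of_ringEquiv (FGModuleCat.endRingEquiv P)).of_free_extension
    { f with commutes' := fun _ ↦ rfl } φ hφl hφr).of_mulOpposite
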